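/- Let $\mathcal H$ be a complex Hilbert space. For a bounded self-adjoint operator $A$ on $\mathcal H$, a bounded Borel function $f:\sigma(A)\to\mathbb R$ and a Borel set $\Delta\subseteq\sigma(A)$, let $f(A)=\int_{\sigma(A)} f\,dE^A$ and let $E[A\in\Delta]=\chi_\Delta(A)$ be the spectral projector. Let $\mathcal O$ be the category whose objects are the bounded self-adjoint operators on $\mathcal H$, with exactly one morphism $B\to A$, denoted $f$, if $B=f(A)$ for some bounded Borel function $f:\sigma(A)\to\mathbb R$, and none otherwise. For such a morphism $f:B\to A$ put $$E[B\in f(\Delta)]:=\inf\{E[B\in K]\;:\;K\subseteq\sigma(B)\text{ Borel},\ E[A\in\Delta]\le E[B\in K]\},$$ the infimum being taken in the lattice of projectors on $\mathcal H$. For a projector $P$ and a density matrix $\rho$ (a positive operator with $\operatorname{tr}\rho=1$) define sieves on $A$ in $\mathcal O$ by $$\nu^P(A\in\Delta)=\{f:B\to A\mid P\le E[B\in f(\Delta)]\},\qquad \nu^\rho(A\in\Delta)=\{f:B\to A\mid \operatorname{tr}(\rho\,E[B\in f(\Delta)])=1\}.$$ **Theorem.** Let $P$ be a projector on $\mathcal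 H$ whose range has finite dimension $n\ge 1$. Then $\rho^P:=\frac1n P$ is a density matrix, and for every bounded self-adjoint operator $A$ and every Borel set $\Delta\subseteq\sigma(A)$, $$\nu^P(A\in\Delta)=\nu^{\rho^P}(A\in\Delta).$$ -/

import Mathlib

namespace QuantumValuation

section

open MeasureTheory
open scoped InnerProductSpace

variable {H : Type*} [NormedAddCommGroup H] [InnerProductSpace ℂ H] [CompleteSpace H]

/-- A bounded physical quantity: a bounded self-adjoint operator on `H`. -/
structure Observable (H : Type*) [NormedAddCommGroup H] [InnerProductSpace ℂ H]
    [CompleteSpace H] where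
  op : H →L[ℂ] H
  isSelfAdjoint : IsSelfAdjoint op

/-- Bounded Borel functions on a measurable space. -/
structure IsBddBorel {X : Type*} [MeasurableSpace X] (f : X → ℝ) : Prop where
  measurable : Measurable f
  bounded : ∃ C : ℝ, ∀ x, |f x| ≤ C

theorem IsBddBorel.memLp {X : Type*} [MeasurableSpace X] {f : X → ℝ} (hf : IsBddBorel f)
    (μ : Measure X) [IsFiniteMeasure μ] (p : ENNReal) : MemLp f p μ := by
  obtain ⟨C, hC⟩ := hf.bounded
  exact MemLp.of_bound hf.measurable.aestronglyMeasurable C (Filter.Eventually.of_forall hC)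

theorem IsBddBorel.integrable {X : Type*} [MeasurableSpace X] {f : X → ℝ} (hf : IsBddBorel f)
    (μ : Measure X) [IsFiniteMeasure μ] : Integrable f μ :=
  memLp_one_iff_integrable.1 (hf.memLp μ 1)

theorem isBddBorel_cont {X : Type*} [MeasurableSpace X] [TopologicalSpace X] [BorelSpace X]
    [CompactSpace X] (g : C(X, ℝ)) : IsBddBorel g :=
  ⟨g.continuous.measurable, ‖g‖, fun x => g.norm_coe_le_norm x⟩

theorem IsBddBorel.sub {X : Type*} [MeasurableSpace X] {f g : X → ℝ} (hf : IsBddBorel f)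
    (hg : IsBddBorel g) : IsBddBorel (fun x => f x - g x) := by
  obtain ⟨C, hC⟩ := hf.bounded
  obtain ⟨D, hD⟩ := hg.bounded
  exact ⟨hf.measurable.sub hg.measurable, C + D,
    fun x => (abs_sub _ _).trans (add_le_add (hC x) (hD x))⟩

theorem IsBddBorel.mul {X : Type*} [MeasurableSpace X] {f g : X → ℝ} (hf : IsBddBorel f)
    (hg : IsBddBorel g) : IsBddBorel (fun x => f x * g x) := by
  obtain ⟨C, hC⟩ := hf.bounded
  obtain ⟨D, hD⟩ := hg.bounded
  refine ⟨hf.measurable.mul hg.measurable, C * D, fun x => ?_⟩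
  rw [abs_mul]
  exact mul_le_mul (hC x) (hD x) (abs_nonneg _) ((abs_nonneg _).trans (hC x))

theorem IsBddBorel.pow {X : Type*} [MeasurableSpace X] {f : X → ℝ} (hf : IsBddBorel f) (k : ℕ) :
    IsBddBorel (fun x => f x ^ k) := by
  obtain ⟨C, hC⟩ := hf.bounded
  refine ⟨hf.measurable.pow_const k, C ^ k, fun x => ?_⟩
  rw [abs_pow]
  exact pow_le_pow_left₀ (abs_nonneg _) (hC x) k

theorem integral_sub_sq {X : Type*} [MeasurableSpace X] {f g : X → ℝ} (hf : IsBddBorel f)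
    (hg : IsBddBorel g) (μ : Measure X) [IsFiniteMeasure μ] :
    ∫ x, (f x - g x) ^ 2 ∂μ = ∫ x, f x ^ 2 ∂μ - 2 * ∫ x, f x * g x ∂μ + ∫ x, g x ^ 2 ∂μ := by
  have hi1 : Integrable (fun x => f x ^ 2) μ := by
    simpa [sq] using (hf.mul hf).integrable μ
  have hi2 : Integrable (fun x => g x ^ 2) μ := by
    simpa [sq] using (hg.mul hg).integrable μ
  have hi3 := ((hf.mul hg).integrable μ).const_mul 2
  have hi4 : Integrable (fun x => f x ^ 2 - 2 * (f x * g x)) μ := hi1.sub hi3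
  rw [← integral_const_mul, ← integral_sub hi1 hi3, ← integral_add hi4 hi2]
  congr 1
  ext x
  ring

theorem exists_cont_approx {X : Type*} [MeasurableSpace X] [TopologicalSpace X] [BorelSpace X]
    [CompactSpace X] [T4Space X] {f : X → ℝ} (hf : IsBddBorel f) (μ : Measure X)
    [IsFiniteMeasure μ] [μ.WeaklyRegular] {ε : ℝ} (hε : 0 < ε) :
    ∃ g : C(X, ℝ), ∫ x, (f x - g x) ^ 2 ∂μ ≤ ε := by
  obtain ⟨g, hg, -⟩ := MemLp.exists_boundedContinuous_integral_rpow_sub_le (p := 2) (by norm_num)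
    (hf.memLp μ (ENNReal.ofReal 2)) hε
  refine ⟨g.toContinuousMap, ?_⟩
  refine le_of_eq_of_le (integral_congr_ae (Filter.Eventually.of_forall fun x => ?_)) hg
  simp

theorem integral_sq_sub_le {X : Type*} [MeasurableSpace X] {f g h : X → ℝ} (hf : IsBddBorel f)
    (hg : IsBddBorel g) (hh : IsBddBorel h) (μ : Measure X) [IsFiniteMeasure μ] :
    Real.sqrt (∫ x, (f x - h x) ^ 2 ∂μ) ≤
      Real.sqrt (∫ x, (f x - g x) ^ 2 ∂μ) + Real.sqrt (∫ x, (g x - h x) ^ 2 ∂μ) := by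
  have key : ∀ {u v : X → ℝ} (hu : IsBddBorel u) (hv : IsBddBorel v),
      Real.sqrt (∫ x, (u x - v x) ^ 2 ∂μ) =
        dist ((hu.memLp μ 2).toLp u) ((hv.memLp μ 2).toLp v) := by
    intro u v hu hv
    rw [dist_eq_norm, ← MemLp.toLp_sub, Lp.norm_toLp,
      (hu.memLp μ 2 |>.sub (hv.memLp μ 2)).eLpNorm_eq_integral_rpow_norm (by norm_num) (by norm_num),
      ENNReal.toReal_ofReal (by positivity), Real.sqrt_eq_rpow]
    simp
  rw [key hf hh, key hf hg, key hg hh]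
  exact dist_triangle _ _ _

namespace Observable

/-- The (real) spectrum `σ(A)`. -/
abbrev spec (A : Observable H) : Set ℝ := spectrum ℝ A.op

/-- The operator `g(A)` for a continuous function `g` on `σ(A)`. -/
noncomputable def contFun (A : Observable H) (g : C(A.spec, ℝ)) : H →L[ℂ] H :=
  cfcHom A.isSelfAdjoint g

/-- The positive functional `g ↦ ⟨ψ, g(A) ψ⟩` on continuous functions on `σ(A)`. -/
noncomputable def stateFunctional (A : Observable H) (ψ : H) :
    CompactlySupportedContinuousMap A.spec ℝ →ₚ[ℝ] ℝ :=
  PositiveLinearMap.mk₀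
    { toFun := fun g => (⟪ψ, A.contFun g.toContinuousMap ψ⟫_ℂ).re
      map_add' := fun g h => by
        have : (g + h).toContinuousMap = g.toContinuousMap + h.toContinuousMap := rfl
        simp [contFun, this, map_add]
      map_smul' := fun c g => by
        have : (c • g).toContinuousMap = c • g.toContinuousMap := rfl
        have h2 : A.contFun (c • g.toContinuousMap) = c • A.contFun g.toContinuousMap :=
          map_smul (cfcHom A.isSelfAdjoint) c g.toContinuousMap
        rw [this, h2, _root_.smul_apply, inner_smul_right_eq_smul]
        simp }
    (fun g hg => by
      have h1 : 0 ≤ A.contFun g.toContinuousMap := by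
        have := cfcHom_nonneg_iff A.isSelfAdjoint (f := g.toContinuousMap)
        exact this.2 hg
      exact ((ContinuousLinearMap.nonneg_iff_isPositive _).1 h1).re_inner_nonneg_right ψ)

/-- The spectral measure `Δ ↦ ⟨ψ, E[A ∈ Δ] ψ⟩` of `A` at the vector `ψ`, a Borel measure
on `σ(A)`: the measure that represents the functional `g ↦ ⟨ψ, g(A) ψ⟩`. -/
noncomputable def specMeasure (A : Observable H) (ψ : H) : Measure A.spec :=
  RealRMK.rieszMeasure (A.stateFunctional ψ)

instance (A : Observable H) (ψ : H) : (A.specMeasure ψ).Regular := by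
  unfold specMeasure; infer_instance

theorem contFun_isSelfAdjoint (A : Observable H) (g : C(A.spec, ℝ)) :
    IsSelfAdjoint (A.contFun g) := cfcHom_predicate A.isSelfAdjoint g

theorem contFun_symm (A : Observable H) (g : C(A.spec, ℝ)) (φ ψ : H) :
    ⟪A.contFun g φ, ψ⟫_ℂ = ⟪φ, A.contFun g ψ⟫_ℂ :=
  (ContinuousLinearMap.isSelfAdjoint_iff_isSymmetric.1 (A.contFun_isSelfAdjoint g)) φ ψ

theorem integral_specMeasure (A : Observable H) (ψ : H) (g : C(A.spec, ℝ)) :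
    ∫ x, g x ∂(A.specMeasure ψ) = (⟪ψ, A.contFun g ψ⟫_ℂ).re :=
  RealRMK.integral_rieszMeasure (A.stateFunctional ψ)
    (CompactlySupportedContinuousMap.continuousMapEquiv g)

theorem specMeasure_univ (A : Observable H) (ψ : H) :
    (A.specMeasure ψ).real Set.univ = ‖ψ‖ ^ 2 := by
  have h := A.integral_specMeasure ψ 1
  have h1 : A.contFun 1 = 1 := map_one (cfcHom A.isSelfAdjoint)
  rw [h1] at h
  simpa [inner_self_eq_norm_sq_to_K, ← Complex.ofReal_pow] using h

theorem norm_contFun_sq (A : Observable H) (ψ : H) (g : C(A.spec, ℝ)) :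
    ‖A.contFun g ψ‖ ^ 2 = ∫ x, g x ^ 2 ∂(A.specMeasure ψ) := by
  have h := A.integral_specMeasure ψ (g * g)
  have h1 : A.contFun (g * g) = A.contFun g * A.contFun g :=
    map_mul (cfcHom A.isSelfAdjoint) g g
  rw [h1, mul_apply_eq_comp, ← contFun_symm, inner_self_eq_norm_sq_to_K] at h
  simpa [sq, ← Complex.ofReal_mul] using h.symm

theorem contFun_sub (A : Observable H) (g h : C(A.spec, ℝ)) :
    A.contFun (g - h) = A.contFun g - A.contFun h := map_sub (cfcHom A.isSelfAdjoint) g h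

/-- The `L²(μ)` distance. -/
noncomputable def l2Dist {X : Type*} [MeasurableSpace X] (μ : Measure X) (f g : X → ℝ) : ℝ :=
  Real.sqrt (∫ x, (f x - g x) ^ 2 ∂μ)

theorem l2Dist_comm {X : Type*} [MeasurableSpace X] (μ : Measure X) (f g : X → ℝ) :
    l2Dist μ f g = l2Dist μ g f := by
  unfold l2Dist
  congr 2
  ext x
  ring

theorem l2Dist_sq {X : Type*} [MeasurableSpace X] (μ : Measure X) (f g : X → ℝ) :
    l2Dist μ f g ^ 2 = ∫ x, (f x - g x) ^ 2 ∂μ :=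
  Real.sq_sqrt (integral_nonneg fun _ => sq_nonneg _)

theorem norm_contFun_sub (A : Observable H) (ψ : H) (g h : C(A.spec, ℝ)) :
    ‖A.contFun g ψ - A.contFun h ψ‖ = l2Dist (A.specMeasure ψ) g h := by
  rw [← sub_apply, ← contFun_sub, l2Dist, ← Real.sqrt_sq (norm_nonneg _),
    norm_contFun_sq]
  rfl

theorem exists_vec (A : Observable H) {f : A.spec → ℝ} (hf : IsBddBorel f) (ψ : H) :
    ∃ v : H, ∀ g : C(A.spec, ℝ),
      ‖v - A.contFun g ψ‖ = l2Dist (A.specMeasure ψ) f g := by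
  set μ := A.specMeasure ψ with hμ
  have hex : ∀ n : ℕ, ∃ g : C(A.spec, ℝ), l2Dist μ f g ≤ 1 / ((n : ℝ) + 1) := by
    intro n
    have hn : (0 : ℝ) < 1 / ((n : ℝ) + 1) := Nat.one_div_pos_of_nat
    obtain ⟨g, hg⟩ := exists_cont_approx hf μ (pow_pos hn 2)
    exact ⟨g, (Real.sqrt_le_sqrt hg).trans_eq (Real.sqrt_sq hn.le)⟩
  choose g hg using hex
  have hlim : Filter.Tendsto (fun n : ℕ => 1 / ((n : ℝ) + 1)) Filter.atTop (nhds 0) :=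
    tendsto_one_div_add_atTop_nhds_zero_nat
  have hD : Filter.Tendsto (fun n => l2Dist μ f (g n)) Filter.atTop (nhds 0) :=
    squeeze_zero (fun n => Real.sqrt_nonneg _) hg hlim
  have hc : CauchySeq fun n => A.contFun (g n) ψ := by
    refine cauchySeq_of_le_tendsto_0 (fun n : ℕ => 2 * (1 / ((n : ℝ) + 1))) ?_ ?_
    · intro n m N hn hm
      rw [dist_eq_norm, norm_contFun_sub]
      refine (integral_sq_sub_le (isBddBorel_cont (g n)) hf (isBddBorel_cont (g m)) μ).trans ?_
      change l2Dist μ (g n) f + l2Dist μ f (g m) ≤ _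
      rw [l2Dist_comm]
      have := hg n
      have := hg m
      have h1 := Nat.one_div_le_one_div (α := ℝ) hn
      have h2 := Nat.one_div_le_one_div (α := ℝ) hm
      linarith
    · simpa using hlim.const_mul 2
  obtain ⟨v, hv⟩ := cauchySeq_tendsto_of_complete hc
  refine ⟨v, fun h => ?_⟩
  have h1 : Filter.Tendsto (fun n => ‖A.contFun (g n) ψ - A.contFun h ψ‖) Filter.atTop
      (nhds ‖v - A.contFun h ψ‖) := (hv.sub_const _).norm
  refine tendsto_nhds_unique h1 ?_
  simp_rw [norm_contFun_sub]
  rw [tendsto_iff_dist_tendsto_zero]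
  refine squeeze_zero (fun n => dist_nonneg) (fun n => ?_) hD
  rw [Real.dist_eq, abs_le]
  have a1 := integral_sq_sub_le (isBddBorel_cont (g n)) hf (isBddBorel_cont h) μ
  have a2 := integral_sq_sub_le hf (isBddBorel_cont (g n)) (isBddBorel_cont h) μ
  change l2Dist μ (g n) h ≤ l2Dist μ (g n) f + l2Dist μ f h at a1
  change l2Dist μ f h ≤ l2Dist μ f (g n) + l2Dist μ (g n) h at a2
  rw [l2Dist_comm μ (g n) f] at a1
  constructor <;> linarith

theorem l2Dist_mono {X : Type*} [MeasurableSpace X] {f g : X → ℝ} (hf : IsBddBorel f)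
    (hg : IsBddBorel g) {μ ν : Measure X} [IsFiniteMeasure ν] (h : μ ≤ ν) :
    l2Dist μ f g ≤ l2Dist ν f g := by
  refine Real.sqrt_le_sqrt (integral_mono_measure h
    (Filter.Eventually.of_forall fun x => sq_nonneg _) ?_)
  have := ((hf.sub hg).mul (hf.sub hg)).integrable ν
  simpa [sq] using this

theorem exists_cont_approx_three (A : Observable H) {f : A.spec → ℝ} (hf : IsBddBorel f)
    (ψ₁ ψ₂ ψ₃ : H) {ε : ℝ} (hε : 0 < ε) :
    ∃ g : C(A.spec, ℝ), l2Dist (A.specMeasure ψ₁) f g ≤ ε ∧ l2Dist (A.specMeasure ψ₂) f g ≤ ε ∧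
      l2Dist (A.specMeasure ψ₃) f g ≤ ε := by
  obtain ⟨g, hg⟩ := exists_cont_approx hf
    (A.specMeasure ψ₁ + A.specMeasure ψ₂ + A.specMeasure ψ₃) (pow_pos hε 2)
  have hg' := (Real.sqrt_le_sqrt hg).trans_eq (Real.sqrt_sq hε.le)
  refine ⟨g, ?_, ?_, ?_⟩ <;> refine (l2Dist_mono hf (isBddBorel_cont g) ?_).trans hg'
  · rw [add_assoc]; exact Measure.le_add_right le_rfl
  · exact Measure.le_add_right (Measure.le_add_left le_rfl)
  · exact Measure.le_add_left le_rfl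

theorem exists_op_aux (A : Observable H) {f : A.spec → ℝ} (hf : IsBddBorel f) :
    ∃ T : H →L[ℂ] H, ∀ (ψ : H) (g : C(A.spec, ℝ)),
      ‖T ψ - A.contFun g ψ‖ = l2Dist (A.specMeasure ψ) f g := by
  choose T hT using A.exists_vec hf
  obtain ⟨C, hC⟩ := hf.bounded
  have hz : ∀ x : H, (∀ ε : ℝ, 0 < ε → ‖x‖ ≤ 3 * ε) → x = 0 := by
    intro x hx
    rw [← norm_le_zero_iff]
    refine le_of_forall_pos_le_add fun ε hε => ?_
    have := hx (ε / 3) (by positivity)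
    linarith
  have hadd : ∀ ψ φ, T (ψ + φ) = T ψ + T φ := by
    intro ψ φ
    rw [← sub_eq_zero]
    refine hz _ fun ε hε => ?_
    obtain ⟨g, h1, h2, h3⟩ := A.exists_cont_approx_three hf ψ φ (ψ + φ) hε
    rw [← hT] at h1 h2 h3
    have : T (ψ + φ) - (T ψ + T φ) = (T (ψ + φ) - A.contFun g (ψ + φ)) -
        (T ψ - A.contFun g ψ) - (T φ - A.contFun g φ) := by
      rw [map_add]; abel
    rw [this]
    have a1 := norm_sub_le ((T (ψ + φ) - A.contFun g (ψ + φ)) -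
        (T ψ - A.contFun g ψ)) (T φ - A.contFun g φ)
    have a2 := norm_sub_le (T (ψ + φ) - A.contFun g (ψ + φ)) (T ψ - A.contFun g ψ)
    linarith
  have hsmul : ∀ (c : ℂ) ψ, T (c • ψ) = c • T ψ := by
    intro c ψ
    rw [← sub_eq_zero, ← norm_le_zero_iff]
    refine le_of_forall_pos_le_add fun ε hε => ?_
    have hc : 0 < 1 + ‖c‖ := by positivity
    obtain ⟨g, h1, h2, -⟩ := A.exists_cont_approx_three hf ψ (c • ψ) 0
      (show 0 < ε / (1 + ‖c‖) by positivity)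
    rw [← hT] at h1 h2
    have : T (c • ψ) - c • T ψ = (T (c • ψ) - A.contFun g (c • ψ)) -
        c • (T ψ - A.contFun g ψ) := by
      rw [map_smul, smul_sub]; abel
    rw [this]
    have a1 := norm_sub_le (T (c • ψ) - A.contFun g (c • ψ)) (c • (T ψ - A.contFun g ψ))
    rw [norm_smul] at a1
    have a2 := mul_le_mul_of_nonneg_left h1 (norm_nonneg c)
    have a3 : (1 + ‖c‖) * (ε / (1 + ‖c‖)) = ε := by field_simp
    linarith
  have hbd : ∀ ψ, ‖T ψ‖ ≤ |C| * ‖ψ‖ := by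
    intro ψ
    have h0 : A.contFun 0 = 0 := map_zero (cfcHom A.isSelfAdjoint)
    have h := hT ψ 0
    rw [h0, zero_apply, sub_zero] at h
    rw [h]
    refine Real.sqrt_le_iff.2 ⟨by positivity, ?_⟩
    rw [mul_pow, ← A.specMeasure_univ ψ, sq_abs]
    have : ∫ x, (f x - (0 : C(A.spec, ℝ)) x) ^ 2 ∂(A.specMeasure ψ) ≤
        ∫ _, C ^ 2 ∂(A.specMeasure ψ) := by
      refine integral_mono_of_nonneg (Filter.Eventually.of_forall fun x => sq_nonneg _)
        (integrable_const _) (Filter.Eventually.of_forall fun x => ?_)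
      simpa using sq_le_sq.2 ((hC x).trans (le_abs_self C))
    simpa [mul_comm] using this
  exact ⟨LinearMap.mkContinuous ⟨⟨T, hadd⟩, hsmul⟩ |C| hbd, hT⟩

theorem inner_eq_integral_of_dist (A : Observable H) {f : A.spec → ℝ} (hf : IsBddBorel f)
    {T : H →L[ℂ] H} (hT : ∀ (ψ : H) (g : C(A.spec, ℝ)),
      ‖T ψ - A.contFun g ψ‖ = l2Dist (A.specMeasure ψ) f g) (ψ : H) :
    ⟪ψ, T ψ⟫_ℂ = ((∫ x, f x ∂(A.specMeasure ψ) : ℝ) : ℂ) := by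
  apply Complex.ext
  · have h0 := hT ψ 0
    have h1 := hT ψ 1
    have e0 : A.contFun 0 = 0 := map_zero (cfcHom A.isSelfAdjoint)
    have e1 : A.contFun 1 = 1 := map_one (cfcHom A.isSelfAdjoint)
    rw [e0, zero_apply, sub_zero] at h0
    rw [e1, one_apply_eq_self] at h1
    have h0' : ‖T ψ‖ ^ 2 = ∫ x, f x ^ 2 ∂(A.specMeasure ψ) := by
      rw [h0, l2Dist_sq]; simp
    have h1' : ‖T ψ - ψ‖ ^ 2 = ∫ x, (f x - 1) ^ 2 ∂(A.specMeasure ψ) := by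
      rw [h1, l2Dist_sq]; simp
    rw [@norm_sub_sq ℂ] at h1'
    have h1c : IsBddBorel fun _ : A.spec => (1 : ℝ) := ⟨measurable_const, 1, fun _ => by simp⟩
    have e := integral_sub_sq hf h1c (A.specMeasure ψ)
    have e2 : ∫ _, (1 : ℝ) ^ 2 ∂(A.specMeasure ψ) = ‖ψ‖ ^ 2 := by
      rw [← A.specMeasure_univ ψ]; simp
    rw [e2] at e
    simp only [mul_one] at e
    have hre : RCLike.re ⟪T ψ, ψ⟫_ℂ = (⟪ψ, T ψ⟫_ℂ).re := inner_re_symm (𝕜 := ℂ) _ _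
    rw [hre] at h1'
    simp only [Complex.ofReal_re]
    linarith
  · simp only [Complex.ofReal_im]
    rw [← abs_nonpos_iff]
    refine le_of_forall_pos_le_add fun ε hε => ?_
    obtain ⟨g, h1, -, -⟩ := A.exists_cont_approx_three hf ψ 0 0
      (show 0 < ε / (1 + ‖ψ‖) by positivity)
    rw [← hT] at h1
    have hg : (⟪ψ, A.contFun g ψ⟫_ℂ).im = 0 := by
      have := inner_conj_symm (𝕜 := ℂ) ψ (A.contFun g ψ)
      rw [contFun_symm] at this
      exact Complex.conj_eq_iff_im.1 this
    have h2 : (⟪ψ, T ψ⟫_ℂ).im = (⟪ψ, T ψ - A.contFun g ψ⟫_ℂ).im := by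
      rw [inner_sub_right, Complex.sub_im, hg, sub_zero]
    rw [h2]
    refine (Complex.abs_im_le_norm _).trans ((norm_inner_le_norm _ _).trans ?_)
    have a2 := mul_le_mul_of_nonneg_left h1 (norm_nonneg ψ)
    have a3 : (1 + ‖ψ‖) * (ε / (1 + ‖ψ‖)) = ε := by field_simp
    have a4 : 0 ≤ ε / (1 + ‖ψ‖) := by positivity
    linarith

theorem op_ext {S T : H →L[ℂ] H} (h : ∀ ψ, ⟪ψ, S ψ⟫_ℂ = ⟪ψ, T ψ⟫_ℂ) : S = T := by
  have h2 : (S : H →ₗ[ℂ] H) = T := by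
    rw [← ext_inner_map]
    intro x
    have := congrArg (starRingEnd ℂ) (h x)
    rwa [inner_conj_symm, inner_conj_symm] at this
  exact ContinuousLinearMap.coe_injective h2

/-- For every bounded Borel `f` there is exactly one bounded operator `T` with
`⟨ψ, T ψ⟩ = ∫ f d⟨ψ, E[A ∈ ·] ψ⟩` for all `ψ`. -/
theorem existsUnique_borelFun (A : Observable H) {f : A.spec → ℝ} (hf : IsBddBorel f) :
    ∃! T : H →L[ℂ] H, ∀ ψ : H, ⟪ψ, T ψ⟫_ℂ = ((∫ x, f x ∂(A.specMeasure ψ) : ℝ) : ℂ) := by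
  obtain ⟨T, hT⟩ := A.exists_op_aux hf
  exact ⟨T, A.inner_eq_integral_of_dist hf hT,
    fun S hS => op_ext fun ψ => (hS ψ).trans (A.inner_eq_integral_of_dist hf hT ψ).symm⟩

/-- The operator `f(A) = ∫ f(λ) dE^A_λ` for a bounded Borel function `f` on `σ(A)`. -/
noncomputable def borelFun (A : Observable H) (f : A.spec → ℝ) (hf : IsBddBorel f) : H →L[ℂ] H :=
  (A.existsUnique_borelFun hf).choose

theorem inner_borelFun (A : Observable H) {f : A.spec → ℝ} (hf : IsBddBorel f) (ψ : H) :
    ⟪ψ, A.borelFun f hf ψ⟫_ℂ = ((∫ x, f x ∂(A.specMeasure ψ) : ℝ) : ℂ) :=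
  (A.existsUnique_borelFun hf).choose_spec.1 ψ

theorem eq_borelFun (A : Observable H) {f : A.spec → ℝ} (hf : IsBddBorel f) {T : H →L[ℂ] H}
    (hT : ∀ ψ : H, ⟪ψ, T ψ⟫_ℂ = ((∫ x, f x ∂(A.specMeasure ψ) : ℝ) : ℂ)) :
    T = A.borelFun f hf := (A.existsUnique_borelFun hf).choose_spec.2 T hT

theorem norm_borelFun_sq (A : Observable H) {f : A.spec → ℝ} (hf : IsBddBorel f) (ψ : H) :
    ‖A.borelFun f hf ψ‖ ^ 2 = ∫ x, f x ^ 2 ∂(A.specMeasure ψ) := by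
  obtain ⟨T, hT⟩ := A.exists_op_aux hf
  rw [← A.eq_borelFun hf (A.inner_eq_integral_of_dist hf hT)]
  have h0 := hT ψ 0
  have e0 : A.contFun 0 = 0 := map_zero (cfcHom A.isSelfAdjoint)
  rw [e0, zero_apply, sub_zero] at h0
  rw [h0, l2Dist_sq]; simp

theorem isSelfAdjoint_of_inner {T : H →L[ℂ] H} (h : ∀ ψ, (⟪ψ, T ψ⟫_ℂ).im = 0) :
    IsSelfAdjoint T := by
  rw [ContinuousLinearMap.isSelfAdjoint_iff_isSymmetric,
    LinearMap.isSymmetric_iff_inner_map_self_real]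
  intro ψ
  rw [← inner_conj_symm, Complex.conj_conj]
  exact (Complex.conj_eq_iff_im.2 (h ψ)).symm

theorem borelFun_isSelfAdjoint (A : Observable H) {f : A.spec → ℝ} (hf : IsBddBorel f) :
    IsSelfAdjoint (A.borelFun f hf) :=
  isSelfAdjoint_of_inner fun ψ => by rw [inner_borelFun]; simp

theorem inner_symm_of_isSelfAdjoint {T : H →L[ℂ] H} (h : IsSelfAdjoint T) (φ ψ : H) :
    ⟪T φ, ψ⟫_ℂ = ⟪φ, T ψ⟫_ℂ := (ContinuousLinearMap.isSelfAdjoint_iff_isSymmetric.1 h) φ ψ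

theorem borelFun_sub (A : Observable H) {f g : A.spec → ℝ} (hf : IsBddBorel f)
    (hg : IsBddBorel g) :
    A.borelFun (fun x => f x - g x) (hf.sub hg) = A.borelFun f hf - A.borelFun g hg := by
  symm
  refine A.eq_borelFun _ fun ψ => ?_
  rw [sub_apply, inner_sub_right, inner_borelFun, inner_borelFun,
    integral_sub (hf.integrable _) (hg.integrable _), Complex.ofReal_sub]

theorem re_inner_borelFun (A : Observable H) {f g : A.spec → ℝ} (hf : IsBddBorel f)
    (hg : IsBddBorel g) (ψ : H) :
    (⟪A.borelFun f hf ψ, A.borelFun g hg ψ⟫_ℂ).re = ∫ x, f x * g x ∂(A.specMeasure ψ) := by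
  have h := A.norm_borelFun_sq (hf.sub hg) ψ
  rw [borelFun_sub, sub_apply, @norm_sub_sq ℂ, norm_borelFun_sq, norm_borelFun_sq] at h
  have e := integral_sub_sq hf hg (A.specMeasure ψ)
  change _ - 2 * (⟪A.borelFun f hf ψ, A.borelFun g hg ψ⟫_ℂ).re + _ = _ at h
  linarith

theorem borelFun_pow (A : Observable H) {f : A.spec → ℝ} (hf : IsBddBorel f) (k : ℕ) :
    A.borelFun (fun x => f x ^ k) (hf.pow k) = A.borelFun f hf ^ k := by
  symm
  induction k with
  | zero =>
    refine A.eq_borelFun _ fun ψ => ?_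
    simp [specMeasure_univ, inner_self_eq_norm_sq_to_K]
  | succ k ih =>
    refine A.eq_borelFun _ fun ψ => ?_
    have hsa : IsSelfAdjoint (A.borelFun f hf ^ (k + 1)) := (A.borelFun_isSelfAdjoint hf).pow _
    have him : (⟪ψ, (A.borelFun f hf ^ (k + 1)) ψ⟫_ℂ).im = 0 := by
      have := inner_conj_symm (𝕜 := ℂ) ψ ((A.borelFun f hf ^ (k + 1)) ψ)
      rw [inner_symm_of_isSelfAdjoint hsa] at this
      exact Complex.conj_eq_iff_im.1 this
    have hre := A.re_inner_borelFun hf (hf.pow k) ψ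
    rw [← ih, inner_symm_of_isSelfAdjoint (A.borelFun_isSelfAdjoint hf),
      ← mul_apply_eq_comp, ← pow_succ'] at hre
    apply Complex.ext
    · rw [hre, Complex.ofReal_re]
      simp_rw [pow_succ']
    · rw [him, Complex.ofReal_im]

theorem measure_ext_of_moments {μ ν : Measure ℝ} [IsFiniteMeasure μ] [IsFiniteMeasure ν] {M : ℝ}
    (hμ : ∀ᵐ x ∂μ, x ∈ Set.Icc (-M) M) (hν : ∀ᵐ x ∂ν, x ∈ Set.Icc (-M) M)
    (h : ∀ k : ℕ, ∫ x, x ^ k ∂μ = ∫ x, x ^ k ∂ν) : μ = ν := by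
  have hint : ∀ (κ : Measure ℝ) [IsFiniteMeasure κ], (∀ᵐ x ∂κ, x ∈ Set.Icc (-M) M) →
      ∀ g : ℝ → ℝ, Continuous g → Integrable g κ := by
    intro κ _ hκ g hg
    obtain ⟨C, hC⟩ := isCompact_Icc.exists_bound_of_continuousOn (hg.continuousOn (s := Set.Icc (-M) M))
    exact Integrable.of_bound hg.aestronglyMeasurable C (hκ.mono hC)
  have hpoly : ∀ p : Polynomial ℝ, ∫ x, p.eval x ∂μ = ∫ x, p.eval x ∂ν := by
    intro p
    simp_rw [Polynomial.eval_eq_sum_range]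
    rw [integral_finsetSum, integral_finsetSum]
    · simp_rw [integral_const_mul, h]
    · exact fun i _ => hint ν hν _ (by fun_prop)
    · exact fun i _ => hint μ hμ _ (by fun_prop)
  refine ext_of_forall_integral_eq_of_IsFiniteMeasure fun g => ?_
  have hclose : ∀ (κ : Measure ℝ) [IsFiniteMeasure κ], (∀ᵐ x ∂κ, x ∈ Set.Icc (-M) M) →
      ∀ (ε : ℝ) (p : Polynomial ℝ), (∀ x ∈ Set.Icc (-M) M, |p.eval x - g x| < ε) →
      |∫ x, p.eval x ∂κ - ∫ x, g x ∂κ| ≤ ε * κ.real Set.univ := by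
    intro κ _ hκ ε p hp
    rw [← integral_sub (hint κ hκ _ p.continuous) (hint κ hκ _ g.continuous)]
    have hb : ∀ᵐ x ∂κ, ‖p.eval x - g x‖ ≤ ε := hκ.mono fun x hx => (hp x hx).le
    exact norm_integral_le_of_norm_le_const hb
  rw [← sub_eq_zero, ← abs_nonpos_iff]
  refine le_of_forall_pos_le_add fun ε hε => ?_
  have hS : 0 < 1 + μ.real Set.univ + ν.real Set.univ := by positivity
  obtain ⟨p, hp⟩ := exists_polynomial_near_of_continuousOn (-M) M g g.continuous.continuousOn
    (ε / (1 + μ.real Set.univ + ν.real Set.univ)) (by positivity)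
  have h1 := abs_le.1 (hclose μ hμ _ p hp)
  have h2 := abs_le.1 (hclose ν hν _ p hp)
  have h3 := hpoly p
  have h4 : (1 + μ.real Set.univ + ν.real Set.univ) *
    (ε / (1 + μ.real Set.univ + ν.real Set.univ)) = ε := by field_simp
  have h5 : 0 < ε / (1 + μ.real Set.univ + ν.real Set.univ) := by positivity
  rw [abs_le]
  constructor <;> linarith

theorem measurableEmbedding_spec (A : Observable H) :
    MeasurableEmbedding (Subtype.val : A.spec → ℝ) :=
  MeasurableEmbedding.subtype_coe (spectrum.isClosed A.op).measurableSet

/-- If `B = f(A)`, the spectral measures of `B` are the images under `f` of those of `A`. -/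
theorem map_specMeasure {A B : Observable H} {f : A.spec → ℝ} (hf : IsBddBorel f)
    (h : B.op = A.borelFun f hf) (ψ : H) :
    (B.specMeasure ψ).map Subtype.val = (A.specMeasure ψ).map f := by
  have _ : IsFiniteMeasure ((B.specMeasure ψ).map Subtype.val) := inferInstance
  have _ : IsFiniteMeasure ((A.specMeasure ψ).map f) := inferInstance
  obtain ⟨C, hC⟩ := hf.bounded
  obtain ⟨D, hD⟩ := (spectrum.isCompact (𝕜 := ℝ) B.op).isBounded.exists_norm_le
  refine measure_ext_of_moments (M := max C D) ?_ ?_ fun k => ?_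
  · refine (ae_map_iff measurable_subtype_coe.aemeasurable measurableSet_Icc).2 ?_
    exact Filter.Eventually.of_forall fun x => abs_le.1 ((hD x x.2).trans (le_max_right _ _))
  · refine (ae_map_iff hf.measurable.aemeasurable measurableSet_Icc).2 ?_
    exact Filter.Eventually.of_forall fun x => abs_le.1 ((hC x).trans (le_max_left _ _))
  · rw [integral_map measurable_subtype_coe.aemeasurable (by fun_prop),
      integral_map hf.measurable.aemeasurable (by fun_prop)]
    have h1 := A.inner_borelFun (hf.pow k) ψ
    rw [A.borelFun_pow hf, ← h] at h1
    have h2 := B.integral_specMeasure ψ (((ContinuousMap.id ℝ).restrict B.spec) ^ k)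
    have h3 : B.contFun (((ContinuousMap.id ℝ).restrict B.spec) ^ k) = B.op ^ k := by
      rw [contFun, map_pow, cfcHom_id]
    rw [h3, h1] at h2
    simpa using h2

/-- The pre-order on the bounded observables: `B ≤ A` if `B = f(A)` for a bounded Borel
function `f : σ(A) → ℝ`. -/
instance : LE (Observable H) :=
  ⟨fun B A => ∃ (f : A.spec → ℝ) (hf : IsBddBorel f), B.op = A.borelFun f hf⟩

theorem isBddBorel_coe (A : Observable H) : IsBddBorel (fun x : A.spec => (x : ℝ)) := by
  obtain ⟨D, hD⟩ := (spectrum.isCompact (𝕜 := ℝ) A.op).isBounded.exists_norm_le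
  exact ⟨measurable_subtype_coe, D, fun x => hD x x.2⟩

/-- The spectral representation `A = ∫ λ dE^A_λ`. -/
theorem op_eq_borelFun (A : Observable H) : A.op = A.borelFun _ A.isBddBorel_coe := by
  refine A.eq_borelFun _ fun ψ => ?_
  have h2 := A.integral_specMeasure ψ ((ContinuousMap.id ℝ).restrict A.spec)
  have h3 : A.contFun ((ContinuousMap.id ℝ).restrict A.spec) = A.op := by
    rw [contFun, cfcHom_id]
  rw [h3] at h2
  apply Complex.ext
  · rw [← h2, Complex.ofReal_re]
    rfl
  · have := inner_conj_symm (𝕜 := ℂ) ψ (A.op ψ)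
    rw [inner_symm_of_isSelfAdjoint A.isSelfAdjoint] at this
    rw [Complex.conj_eq_iff_im.1 this, Complex.ofReal_im]

theorem le_trans_aux {A B C : Observable H} (h₁ : C ≤ B) (h₂ : B ≤ A) : C ≤ A := by
  obtain ⟨h, hh, hC⟩ := h₁
  obtain ⟨f, hf, hB⟩ := h₂
  have hext : IsBddBorel (Function.extend Subtype.val h (fun _ => 0)) := by
    obtain ⟨D, hD⟩ := hh.bounded
    refine ⟨B.measurableEmbedding_spec.measurable_extend hh.measurable measurable_const,
      max D 0, fun x => ?_⟩
    by_cases hx : ∃ y : B.spec, (y : ℝ) = x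
    · obtain ⟨y, rfl⟩ := hx
      rw [Subtype.val_injective.extend_apply]
      exact (hD y).trans (le_max_left _ _)
    · rw [Function.extend_apply' _ _ _ hx]
      simp
  refine ⟨fun x => Function.extend Subtype.val h (fun _ => 0) (f x),
    ⟨hext.measurable.comp hf.measurable, ?_⟩, ?_⟩
  · obtain ⟨D, hD⟩ := hext.bounded
    exact ⟨D, fun x => hD _⟩
  · refine A.eq_borelFun _ fun ψ => ?_
    rw [hC, inner_borelFun, ← integral_map hf.measurable.aemeasurable
      hext.measurable.aestronglyMeasurable, ← map_specMeasure hf hB,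
      B.measurableEmbedding_spec.integral_map]
    simp_rw [Subtype.val_injective.extend_apply]

/-- The bounded observables form a pre-ordered set, hence a category `𝒪` in which there is at
most one morphism `B ⟶ A`, and there is one precisely if `B = f(A)` for some `f`. -/
instance : Preorder (Observable H) where
  le_refl A := ⟨_, A.isBddBorel_coe, A.op_eq_borelFun⟩
  le_trans _ _ _ h₁ h₂ := le_trans_aux h₁ h₂

end Observable

/-- The projection operators on `H`, with the order induced by the order of operators. -/
abbrev Projector (H : Type*) [NormedAddCommGroup H] [InnerProductSpace ℂ H] [CompleteSpace H] :=
  {p : H →L[ℂ] H // IsStarProjection p}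

namespace Projector

/-- The vectors fixed by all projectors of a set, i.e. the intersection of their ranges. -/
def fixed (S : Set (Projector H)) : Submodule ℂ H :=
  ⨅ Q ∈ S, (1 - Q.1 : H →L[ℂ] H).ker

theorem mem_fixed {S : Set (Projector H)} {x : H} : x ∈ fixed S ↔ ∀ Q ∈ S, Q.1 x = x := by
  simp only [fixed, Submodule.mem_iInf]
  refine forall₂_congr fun Q _ => ?_
  change (1 - Q.1 : H →L[ℂ] H) x = 0 ↔ _
  rw [sub_apply, one_apply_eq_self, sub_eq_zero, eq_comm]

theorem isClosed_fixed (S : Set (Projector H)) : IsClosed (fixed S : Set H) := by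
  have : (fixed S : Set H) = ⋂ Q ∈ S, {x | Q.1 x = x} := by
    ext x
    simp [mem_fixed]
  rw [this]
  exact isClosed_biInter fun Q _ => isClosed_eq Q.1.continuous continuous_id

instance (S : Set (Projector H)) : CompleteSpace (fixed S) :=
  (isClosed_fixed S).completeSpace_coe

/-- The infimum of a set of projectors in the lattice of projectors: the orthogonal projection
onto the intersection of their ranges. -/
noncomputable def inf (S : Set (Projector H)) : Projector H :=
  ⟨(fixed S).starProjection, isStarProjection_starProjection⟩

theorem le_iff {P Q : Projector H} : P ≤ Q ↔ ∀ x, Q.1 (P.1 x) = P.1 x := by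
  change P.1 ≤ Q.1 ↔ _
  rw [P.2.le_iff_mul_eq_right Q.2, ContinuousLinearMap.ext_iff]
  rfl

theorem isGLB_inf (S : Set (Projector H)) : IsGLB S (inf S) := by
  constructor
  · intro Q hQ
    rw [le_iff]
    intro x
    exact mem_fixed.1 ((fixed S).starProjection_apply_mem x) Q hQ
  · intro R hR
    rw [le_iff]
    intro x
    refine Submodule.starProjection_eq_self_iff.2 (mem_fixed.2 fun Q hQ => ?_)
    exact le_iff.1 (hR hQ) x

end Projector

namespace Observable

theorem isBddBorel_indicator {X : Type*} [MeasurableSpace X] {Δ : Set X} (hΔ : MeasurableSet Δ) :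
    IsBddBorel (Δ.indicator fun _ => (1 : ℝ)) :=
  ⟨measurable_const.indicator hΔ, 1, fun x => by by_cases h : x ∈ Δ <;> simp [h]⟩

/-- The spectral projector `E[A ∈ Δ] = χ_Δ(A)`, for a Borel set `Δ ⊆ σ(A)`. -/
noncomputable def specProj (A : Observable H) (Δ : Set A.spec) (hΔ : MeasurableSet Δ) :
    Projector H :=
  ⟨A.borelFun (Δ.indicator fun _ => 1) (isBddBorel_indicator hΔ), by
    refine ⟨?_, A.borelFun_isSelfAdjoint _⟩
    rw [IsIdempotentElem, ← sq, ← borelFun_pow]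
    congr 1
    ext x
    by_cases h : x ∈ Δ <;> simp [h]⟩

theorem inner_specProj (A : Observable H) {Δ : Set A.spec} (hΔ : MeasurableSet Δ) (ψ : H) :
    ⟪ψ, (A.specProj Δ hΔ).1 ψ⟫_ℂ = (((A.specMeasure ψ).real Δ : ℝ) : ℂ) := by
  rw [specProj, inner_borelFun, integral_indicator_const _ hΔ]
  simp

/-- The projector `E[B ∈ f(Δ)]` for `B = f(A)`: the infimum of all spectral projectors
`E[B ∈ K]`, `K ⊆ σ(B)` Borel, that satisfy `E[A ∈ Δ] ≤ E[B ∈ K]`. It depends on `f` only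
through the operator `B = f(A)`. -/
noncomputable def imageProj (A : Observable H) (Δ : Set A.spec) (hΔ : MeasurableSet Δ)
    (B : Observable H) : Projector H :=
  Projector.inf {Q | ∃ (K : Set B.spec) (hK : MeasurableSet K),
    Q = B.specProj K hK ∧ A.specProj Δ hΔ ≤ B.specProj K hK}

theorem exists_specProj_eq {B C : Observable H} (h : C ≤ B) (K : Set C.spec)
    (hK : MeasurableSet K) : ∃ (L : Set B.spec) (hL : MeasurableSet L),
      C.specProj K hK = B.specProj L hL := by
  obtain ⟨f, hf, hC⟩ := h
  have hK' : MeasurableSet (Subtype.val '' K : Set ℝ) :=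
    C.measurableEmbedding_spec.measurableSet_image.2 hK
  refine ⟨f ⁻¹' (Subtype.val '' K), hf.measurable hK', Subtype.ext (op_ext fun ψ => ?_)⟩
  rw [inner_specProj, inner_specProj, Measure.real, Measure.real,
    ← Measure.map_apply hf.measurable hK', ← map_specMeasure hf hC,
    C.measurableEmbedding_spec.map_apply, Subtype.val_injective.preimage_image]

theorem imageProj_mono (A : Observable H) {Δ : Set A.spec} (hΔ : MeasurableSet Δ)
    {B C : Observable H} (h : C ≤ B) : A.imageProj Δ hΔ B ≤ A.imageProj Δ hΔ C := by
  refine (Projector.isGLB_inf _).2 ?_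
  rintro Q ⟨K, hK, rfl, hQ⟩
  obtain ⟨L, hL, e⟩ := exists_specProj_eq h K hK
  exact (Projector.isGLB_inf _).1 ⟨L, hL, e, e ▸ hQ⟩

end Observable

/-- `T` has trace `t`: the diagonal sums of `T` converge unconditionally to `t` in every
orthonormal basis. -/
def HasTrace (T : H →L[ℂ] H) (t : ℂ) : Prop :=
  ∀ (w : Set H) (b : HilbertBasis w ℂ H), HasSum (fun i => ⟪b i, T (b i)⟫_ℂ) t

/-- Density matrices: positive operators of trace one. -/
structure IsDensityMatrix (ρ : H →L[ℂ] H) : Prop where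
  isPositive : ρ.IsPositive
  trace_eq_one : HasTrace ρ 1

theorem exists_adapted_basis (E : Projector H) :
    ∃ (w : Set H) (b : HilbertBasis w ℂ H), ∀ i, E.1 (b i) = b i ∨ E.1 (b i) = 0 := by
  set K : Submodule ℂ H := E.1.ker
  have : CompleteSpace K := E.1.isClosed_ker.completeSpace_coe
  obtain ⟨s, c, hc⟩ := exists_hilbertBasis ℂ K
  have ho : Orthonormal ℂ (fun i : s => ((c i : K) : H)) :=
    c.orthonormal.comp_linearIsometry K.subtypeₗᵢ
  obtain ⟨w, b, hw, hb⟩ := ho.toSubtypeRange.exists_hilbertBasis_extension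
  refine ⟨w, b, fun i => ?_⟩
  by_cases hi : (i : H) ∈ Set.range (fun i : s => ((c i : K) : H))
  · right
    obtain ⟨j, hj⟩ := hi
    rw [hb]
    rw [← hj]
    exact (c j).2
  · left
    have horth : ∀ x ∈ K, ⟪x, b i⟫_ℂ = 0 := by
      intro x hx
      have hd := c.dense_span
      have hcl : IsClosed {y : K | ⟪(y : H), b i⟫_ℂ = 0} :=
        isClosed_eq (by fun_prop) continuous_const
      have hsub : (Submodule.span ℂ (Set.range c)).topologicalClosure ≤
          ((innerSL ℂ (b i)).comp K.subtypeL).ker := by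
        refine Submodule.topologicalClosure_minimal _ ?_ (ContinuousLinearMap.isClosed_ker _)
        rw [Submodule.span_le]
        rintro _ ⟨j, rfl⟩
        change ⟪b i, ((c j : K) : H)⟫_ℂ = 0
        have hjw : ((c j : K) : H) ∈ w := hw ⟨j, rfl⟩
        have hj : b ⟨_, hjw⟩ = ((c j : K) : H) := by rw [hb]
        rw [← hj]
        refine b.orthonormal.2 fun e => hi ⟨j, ?_⟩
        rw [e]
      have hx' : (⟨x, hx⟩ : K) ∈ ((innerSL ℂ (b i)).comp K.subtypeL).ker :=
        hsub (hd ▸ Submodule.mem_top)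
      have hx'' : ⟪b i, x⟫_ℂ = 0 := hx'
      rw [← inner_conj_symm, hx'', map_zero]
    have hmem : b i - E.1 (b i) ∈ K := by
      change E.1 (b i - E.1 (b i)) = 0
      have : E.1 (E.1 (b i)) = E.1 (b i) := congrArg (fun T : H →L[ℂ] H => T (b i)) E.2.1
      rw [map_sub, this, sub_self]
    have h0 := horth _ hmem
    have h1 : ⟪b i - E.1 (b i), E.1 (b i)⟫_ℂ = 0 := by
      rw [← Observable.inner_symm_of_isSelfAdjoint E.2.2]
      have : E.1 (b i - E.1 (b i)) = 0 := hmem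
      rw [this, inner_zero_left]
    have h2 : ⟪b i - E.1 (b i), b i - E.1 (b i)⟫_ℂ = 0 := by
      rw [inner_sub_right, h0, h1, sub_zero]
    exact (sub_eq_zero.1 (inner_self_eq_zero.1 h2)).symm

/-- For a density matrix, `tr(ρ E) = 1` is inherited by larger projectors. -/
theorem IsDensityMatrix.hasTrace_mono {ρ : H →L[ℂ] H} (hρ : IsDensityMatrix ρ)
    {E F : Projector H} (hEF : E ≤ F) (hE : HasTrace (ρ * E.1) 1) : HasTrace (ρ * F.1) 1 := by
  have key : ρ * E.1 = ρ := by
    obtain ⟨w, b, hb⟩ := exists_adapted_basis E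
    have hs := (hρ.trace_eq_one w b).sub (hE w b)
    rw [sub_self] at hs
    have hker : ∀ x, (⟪x, ρ x⟫_ℂ).re = 0 → ρ x = 0 := by
      intro x hx
      obtain ⟨S, rfl⟩ := CStarAlgebra.nonneg_iff_eq_star_mul_self.1
        ((ContinuousLinearMap.nonneg_iff_isPositive ρ).2 hρ.isPositive)
      rw [mul_apply_eq_comp, ContinuousLinearMap.star_eq_adjoint,
        ContinuousLinearMap.adjoint_inner_right, inner_self_eq_norm_sq_to_K] at hx
      have hS : S x = 0 := by simpa [← Complex.ofReal_pow] using hx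
      rw [mul_apply_eq_comp, hS, map_zero]
    have hterm : ∀ i, ρ (b i) = ρ (E.1 (b i)) := by
      have hnn : ∀ i, 0 ≤ (⟪b i, ρ (b i)⟫_ℂ - ⟪b i, (ρ * E.1) (b i)⟫_ℂ).re := by
        intro i
        rw [mul_apply_eq_comp]
        rcases hb i with h | h
        · rw [h, sub_self]; rfl
        · rw [h, map_zero, inner_zero_right, sub_zero]
          exact hρ.isPositive.re_inner_nonneg_right (b i)
      have hs' := Complex.hasSum_re hs
      rw [Complex.zero_re] at hs'
      have hz := (hasSum_zero_iff_of_nonneg hnn).1 hs'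
      intro i
      rcases hb i with h | h
      · rw [h]
      · have := congrFun hz i
        simp only [Pi.zero_apply, mul_apply_eq_comp, h, map_zero, inner_zero_right,
          sub_zero] at this
        rw [h, map_zero]
        exact hker _ this
    have hd : ∀ x, (ρ - ρ * E.1 : H →L[ℂ] H) x = 0 := by
      intro x
      have hsub : (Submodule.span ℂ (Set.range b)).topologicalClosure ≤
          (ρ - ρ * E.1 : H →L[ℂ] H).ker := by
        refine Submodule.topologicalClosure_minimal _ ?_ (ContinuousLinearMap.isClosed_ker _)
        rw [Submodule.span_le]
        rintro _ ⟨j, rfl⟩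
        change (ρ - ρ * E.1 : H →L[ℂ] H) (b j) = 0
        rw [sub_apply, mul_apply_eq_comp, hterm j, sub_self]
      exact hsub (b.dense_span ▸ Submodule.mem_top)
    exact (sub_eq_zero.1 (ContinuousLinearMap.ext hd)).symm
  have h2 : ρ * F.1 = ρ := by
    have h3 : E.1 * F.1 = E.1 := (E.2.le_iff_mul_eq_left F.2).1 hEF
    rw [← key, mul_assoc, h3]
  rw [h2]
  exact hρ.trace_eq_one

open CategoryTheory

/-- The valuation `ν^P(A ∈ Δ) = {f : B ⟶ A | P ≤ E[B ∈ f(Δ)]}`, a sieve on `A` in `𝒪`. -/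
noncomputable def projectorValuation (P : Projector H) (A : Observable H) (Δ : Set A.spec)
    (hΔ : MeasurableSet Δ) : Sieve A where
  arrows B := {_f : B ⟶ A | P ≤ A.imageProj Δ hΔ B}
  downward_closed hf g := le_trans hf (A.imageProj_mono hΔ (leOfHom g))

/-- The valuation `ν^ρ(A ∈ Δ) = {f : B ⟶ A | tr(ρ E[B ∈ f(Δ)]) = 1}` of a density matrix `ρ`,
a sieve on `A` in `𝒪`. -/
noncomputable def densityValuation (ρ : H →L[ℂ] H) (hρ : IsDensityMatrix ρ) (A : Observable H)
    (Δ : Set A.spec) (hΔ : MeasurableSet Δ) : Sieve A where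
  arrows B := {_f : B ⟶ A | HasTrace (ρ * (A.imageProj Δ hΔ B).1) 1}
  downward_closed hf g := hρ.hasTrace_mono (A.imageProj_mono hΔ (leOfHom g)) hf

end

end QuantumValuation

namespace QuantumValuation

/-!
Let `T` be a positive operator of trace `t` and `Q` a projector. In an orthonormal basis adapted
to `Q` the diagonal entries of `T - T Q` are `0` on the range of `Q` and `⟪b, T b⟫ ≥ 0` on its
kernel, so `tr (T Q) = tr T` forces `T` to vanish on the kernel of `Q`. Hence `tr (T Q) = t` depends
on `T` only through its kernel: replacing `T` by the projector `P` with the same kernel, it says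
`ker Q ≤ ker P`, which is `P ≤ Q`.
-/

open scoped InnerProductSpace ComplexOrder
open InnerProductSpace (rankOne)

section

variable {E : Type*} [NormedAddCommGroup E] [InnerProductSpace ℂ E]

theorem HasTrace.smul {T : E →L[ℂ] E} {t : ℂ} (hT : HasTrace T t) (c : ℂ) :
    HasTrace (c • T) (c * t) := fun w b => by
  simpa only [smul_apply, inner_smul_right] using (hT w b).mul_left c

theorem HasTrace.sum {ι : Type*} {s : Finset ι} {T : ι → E →L[ℂ] E} {t : ι → ℂ}
    (hT : ∀ j ∈ s, HasTrace (T j) (t j)) : HasTrace (∑ j ∈ s, T j) (∑ j ∈ s, t j) := fun w b => by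
  simpa only [sum_apply, inner_sum] using hasSum_sum fun j hj => hT j hj w b

theorem hasTrace_rankOne (x y : E) : HasTrace (rankOne ℂ x y) ⟪y, x⟫_ℂ := fun _ b => by
  simpa only [InnerProductSpace.inner_right_rankOne_apply, mul_comm] using
    b.hasSum_inner_mul_inner y x

end

theorem comp_eq_left_iff_ker_le {R M N : Type*} [Ring R] [AddCommGroup M] [Module R M]
    [TopologicalSpace M] [AddCommGroup N] [Module R N] [TopologicalSpace N] {Q : M →L[R] M}
    (hQ : IsIdempotentElem Q) (T : M →L[R] N) : T ∘L Q = T ↔ Q.ker ≤ T.ker := by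
  rw [← ContinuousLinearMap.coe_inj, ContinuousLinearMap.toLinearMap_comp]
  exact LinearMap.IsIdempotentElem.comp_eq_left_iff
    (ContinuousLinearMap.isIdempotentElem_toLinearMap_iff.2 hQ) _

variable {H : Type*} [NormedAddCommGroup H] [InnerProductSpace ℂ H] [CompleteSpace H]

namespace Projector

theorem le_iff_ker_le {P Q : Projector H} : P ≤ Q ↔ Q.1.ker ≤ P.1.ker :=
  (P.2.le_iff_mul_eq_left Q.2).trans (comp_eq_left_iff_ker_le Q.2.isIdempotentElem P.1)

theorem hasTrace_finrank (P : Projector H) [FiniteDimensional ℂ P.1.range] :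
    HasTrace P.1 (Module.finrank ℂ P.1.range) := by
  obtain ⟨_, hP⟩ := isStarProjection_iff_eq_starProjection_range.1 P.2
  have e := stdOrthonormalBasis ℂ P.1.range
  have hsum : P.1 = ∑ j, rankOne ℂ (e j : H) (e j : H) := hP.trans e.starProjection_eq_sum_rankOne
  have hone (j) : ⟪(e j : H), (e j : H)⟫_ℂ = 1 := e.inner_eq_one j
  have htr := HasTrace.sum fun j (_ : j ∈ Finset.univ) => hasTrace_rankOne (e j : H) (e j : H)
  simpa only [← hsum, hone, Finset.sum_const, Finset.card_univ, Fintype.card_fin, nsmul_one]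
    using htr

end Projector

section Positive

variable {T : H →L[ℂ] H} {t : ℂ}

theorem apply_eq_zero_of_isPositive_of_inner_eq_zero (hT : T.IsPositive) {x : H}
    (hx : ⟪x, T x⟫_ℂ = 0) : T x = 0 := by
  obtain ⟨S, rfl⟩ := CStarAlgebra.nonneg_iff_eq_star_mul_self.1
    ((ContinuousLinearMap.nonneg_iff_isPositive T).2 hT)
  rw [mul_apply_eq_comp, ContinuousLinearMap.star_eq_adjoint,
    ContinuousLinearMap.adjoint_inner_right, inner_self_eq_zero] at hx
  rw [mul_apply_eq_comp, hx, map_zero]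

theorem HasTrace.nonneg (htr : HasTrace T t) (hT : T.IsPositive) : 0 ≤ t := by
  obtain ⟨w, b, -⟩ := exists_hilbertBasis ℂ H
  exact (htr w b).nonneg fun i => hT.inner_nonneg_right (b i)

theorem HasTrace.isDensityMatrix_inv_smul (htr : HasTrace T t) (hT : T.IsPositive) (ht : t ≠ 0) :
    IsDensityMatrix (t⁻¹ • T) where
  isPositive := hT.smul_of_nonneg (inv_nonneg.2 (htr.nonneg hT))
  trace_eq_one := inv_mul_cancel₀ ht ▸ htr.smul t⁻¹

theorem HasTrace.ker_le_of_hasTrace_mul (htr : HasTrace T t) (hT : T.IsPositive)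
    {Q : Projector H} (hTQ : HasTrace (T * Q.1) t) : Q.1.ker ≤ T.ker := by
  obtain ⟨w, b, hb⟩ := exists_adapted_basis Q
  have hfixed {i} (hQ : Q.1 (b i) = b i) :
      ⟪b i, T (b i)⟫_ℂ - ⟪b i, (T * Q.1) (b i)⟫_ℂ = 0 := by
    rw [mul_apply_eq_comp, hQ, sub_self]
  have hkilled {i} (hQ : Q.1 (b i) = 0) :
      ⟪b i, T (b i)⟫_ℂ - ⟪b i, (T * Q.1) (b i)⟫_ℂ = ⟪b i, T (b i)⟫_ℂ := by
    rw [mul_apply_eq_comp, hQ, map_zero, inner_zero_right, sub_zero]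
  have hnonneg (i) : 0 ≤ ⟪b i, T (b i)⟫_ℂ - ⟪b i, (T * Q.1) (b i)⟫_ℂ :=
    (hb i).elim (fun hQ => (hfixed hQ).ge)
      (fun hQ => (hT.inner_nonneg_right (b i)).trans_eq (hkilled hQ).symm)
  have hzero := (hasSum_zero_iff_of_nonneg hnonneg).1 (sub_self t ▸ (htr w b).sub (hTQ w b))
  rw [← comp_eq_left_iff_ker_le Q.2.isIdempotentElem]
  refine ContinuousLinearMap.ext_on
    (Submodule.dense_iff_topologicalClosure_eq_top.2 b.dense_span) ?_
  rintro _ ⟨i, rfl⟩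
  rw [ContinuousLinearMap.comp_apply]
  rcases hb i with hQ | hQ
  · rw [hQ]
  · rw [hQ, map_zero, apply_eq_zero_of_isPositive_of_inner_eq_zero hT
      ((hkilled hQ).symm.trans (congrFun hzero i))]

theorem HasTrace.hasTrace_mul_iff_ker_le (htr : HasTrace T t) (hT : T.IsPositive)
    (Q : Projector H) : HasTrace (T * Q.1) t ↔ Q.1.ker ≤ T.ker := by
  refine ⟨htr.ker_le_of_hasTrace_mul hT, fun hker => ?_⟩
  have hTQ : T * Q.1 = T := (comp_eq_left_iff_ker_le Q.2.isIdempotentElem T).2 hker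
  rwa [hTQ]

end Positive

theorem projectorValuation_eq_densityValuation {ρ : H →L[ℂ] H} (hρ : IsDensityMatrix ρ)
    {P : Projector H} (hker : ρ.ker = P.1.ker) (A : Observable H) (Δ : Set A.spec)
    (hΔ : MeasurableSet Δ) : projectorValuation P A Δ hΔ = densityValuation ρ hρ A Δ hΔ := by
  refine CategoryTheory.Sieve.ext fun B _ => ?_
  change P ≤ A.imageProj Δ hΔ B ↔ HasTrace (ρ * (A.imageProj Δ hΔ B).1) 1
  rw [Projector.le_iff_ker_le, hρ.trace_eq_one.hasTrace_mul_iff_ker_le hρ.isPositive, hker]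

end QuantumValuation

open QuantumValuation in
theorem mainTheorem9_general {H : Type*} [NormedAddCommGroup H] [InnerProductSpace ℂ H]
    [CompleteSpace H] {T : H →L[ℂ] H} {t : ℂ} (hT : T.IsPositive) (htr : HasTrace T t) (ht : t ≠ 0)
    {P : Projector H} (hker : T.ker = P.1.ker) :
    ∃ hρ : IsDensityMatrix (t⁻¹ • T), ∀ (A : Observable H) (Δ : Set A.spec)
      (hΔ : MeasurableSet Δ),
        projectorValuation P A Δ hΔ = densityValuation (t⁻¹ • T) hρ A Δ hΔ :=
  ⟨htr.isDensityMatrix_inv_smul hT ht, projectorValuation_eq_densityValuation _ <|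
    (LinearMap.ker_smul T.toLinearMap t⁻¹ (inv_ne_zero ht)).trans hker⟩

theorem mainTheorem9 {H : Type*} [NormedAddCommGroup H] [InnerProductSpace ℂ H] [CompleteSpace H]
    (P : QuantumValuation.Projector H) (n : ℕ) (hn : 0 < n)
    (hfin : FiniteDimensional ℂ P.1.range) (hrank : Module.finrank ℂ P.1.range = n) :
    ∃ hρ : QuantumValuation.IsDensityMatrix ((n : ℂ)⁻¹ • P.1),
      ∀ (A : QuantumValuation.Observable H) (Δ : Set A.spec) (hΔ : MeasurableSet Δ),
        QuantumValuation.projectorValuation P A Δ hΔ =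
          QuantumValuation.densityValuation ((n : ℂ)⁻¹ • P.1) hρ A Δ hΔ :=
  mainTheorem9_general (.of_isStarProjection P.2) (hrank ▸ P.hasTrace_finrank)
    (Nat.cast_ne_zero.2 hn.ne') rfl
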